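/- **Theorem (Finiteness theorem for joint invariants).** Let $G$ be a connected Lie group with Lie algebra $\mathcal G$, acting smoothly on a smooth manifold $M$, and hence diagonally on every Cartesian power $M^k$. For $X\in\mathcal G$ let $\mathbf{ig}(X)_p=\frac{d}{dt}\big|_{t=0}(e^{tX}p)$ be the corresponding infinitesimal generator on $M$, and for a $k$-tuple $\bar p=(p_1,\dots,p_k)\in M^k$ let $\mathrm{est}(\bar p)=\{X\in\mathcal G:\mathbf{ig}(X)_{p_i}=0 \text{ for } i=1,\dots,k\}$ be the Lie algebra of its stabilizer. Suppose that the action is *locally faithful*: for every nonempty open $U\subseteq M$ the map $X\mapsto \mathbf{ig}(X)|_U$ is injective on $\mathcal G$. Then the action has a finite *local rank* $k_0$, that is, there is a smallest natural number $k_0$ such that $\{\bar p\in M^{k_0}:\mathrm{est}(\bar p)=0\}$ is dense in $M^{k_0}$; and there is $k_1\le k_0+2$ such that, for every $k>k_1$, there is a dense open subset $W_k\subseteq M^k$ over which every local $k$-joint invariant is locally functionally dependent on the liftings of local $k_1$-joint invariants. Here a *local $k$-joint invariant* on an open set $U\subseteq M^k$ is a smooth function $I:U\to\mathbb R$ that is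 locally constant along the orbits: for each $\bar p\in U$ one has $I(g\bar p)=I(\bar p)$ for all $g$ in some neighbourhood of the identity in $G$. A *lifting* of a local $k_1$-joint invariant $f$ is a function $f\circ\pi$, where $\pi:M^k\to M^{k_1}$ is one of the projections that drop $k-k_1$ of the components. The conclusion means: for every open $U\subseteq M^k$, every local $k$-joint invariant $I$ on $U$ and every $\bar p\in U\cap W_k$, there are an open neighbourhood $O$ of $\bar p$ in $U$ and finitely many liftings $h_1,\dots,h_n$ on $O$ of local $k_1$-joint invariants, such that on $O$ $$I=\Phi(h_1,\dots,h_n)\quad\text{and}\quad dI=\sum_{j=1}^n c_j\,dh_j,$$ where $\Phi$ is a smooth function on an open subset of $\mathbb R^n$ and $c_1,\dots,c_n$ are smooth functions on $O$. -/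

import Mathlib

open scoped Manifold ContDiff Topology

namespace JointInvariants

noncomputable section

section Action

variable (F : Type*) [NormedAddCommGroup F] [NormedSpace ℝ F]
  (E : Type*) [NormedAddCommGroup E] [NormedSpace ℝ E]
  (G : Type*) [TopologicalSpace G] [ChartedSpace F G] [Group G]
  {M : Type*} [TopologicalSpace M] [ChartedSpace E M] [MulAction G M]

/-- The infinitesimal generators at `p`: the element `X` of the Lie algebra (the tangent space of
`G` at the identity) is sent to the velocity at `p` of the flow of `exp (t X)`, that is, to the
image of `X` under the differential at `1` of the orbit map `g ↦ g • p`. -/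
def ig (p : M) : GroupLieAlgebra 𝓘(ℝ, F) G →L[ℝ] TangentSpace 𝓘(ℝ, E) p :=
  mfderiv 𝓘(ℝ, F) 𝓘(ℝ, E) (fun g : G => g • p) (1 : G)

/-- The action is locally faithful: for every nonempty open `U`, the linear map sending an element
of the Lie algebra to its infinitesimal generator, as a vector field on `U`, is injective. -/
def LocallyFaithful (M : Type*) [TopologicalSpace M] [ChartedSpace E M] [MulAction G M] : Prop :=
  ∀ U : Set M, IsOpen U → U.Nonempty →
    Function.Injective fun (X : GroupLieAlgebra 𝓘(ℝ, F) G) (p : U) => ig F E G (p : M) X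

/-- The Lie algebra of the stabilizer of the point `p`. -/
def est (p : M) : Submodule ℝ (GroupLieAlgebra 𝓘(ℝ, F) G) :=
  LinearMap.ker (ig F E G p).toLinearMap

/-- The Lie algebra of the stabilizer of the `k`-tuple `p` under the diagonal action. -/
def estTuple {k : ℕ} (p : Fin k → M) : Submodule ℝ (GroupLieAlgebra 𝓘(ℝ, F) G) :=
  ⨅ i, est F E G (p i)

/-- The `k`-tuple `p` is a locally regular point of the diagonal action. -/
def LocallyRegular {k : ℕ} (p : Fin k → M) : Prop :=
  estTuple F E G p = ⊥

/-- The diagonal action on `M ^ k` is generically locally regular. -/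
def GenericallyLocallyRegular (M : Type*) [TopologicalSpace M] [ChartedSpace E M] [MulAction G M]
    (k : ℕ) : Prop :=
  Dense {p : Fin k → M | LocallyRegular F E G p}

/-- `k₀` is the local rank of the action: the smallest natural number for which the diagonal
action on `M ^ k₀` is generically locally regular. -/
def IsLocalRank (M : Type*) [TopologicalSpace M] [ChartedSpace E M] [MulAction G M]
    (k₀ : ℕ) : Prop :=
  IsLeast {k : ℕ | GenericallyLocallyRegular F E G M k} k₀

end Action

section Invariants

variable (E : Type*) [NormedAddCommGroup E] [NormedSpace ℝ E]
  (G : Type*) [TopologicalSpace G] [Group G]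
  {M : Type*} [TopologicalSpace M] [ChartedSpace E M] [MulAction G M]

/-- The model of the product manifold `M ^ k`. -/
abbrev powModel (k : ℕ) : ModelWithCorners ℝ (Fin k → E) (ModelPi fun _ : Fin k => E) :=
  ModelWithCorners.pi fun _ : Fin k => 𝓘(ℝ, E)

/-- `I` is, on the set `U` of `k`-tuples (always an open set below), a local `k`-joint invariant:
a smooth function which is locally constant along the orbits of the diagonal action, the orbits
being given the topology coming from `G`. -/
structure IsLocalJointInvariant {k : ℕ} (U : Set (Fin k → M)) (I : (Fin k → M) → ℝ) : Prop where
  smooth : ContMDiffOn (powModel E k) 𝓘(ℝ, ℝ) ∞ I U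
  locallyConstant : ∀ p ∈ U, ∀ᶠ g in 𝓝 (1 : G), I (g • p) = I p

/-- On the set `O` of `k`-tuples, `h` is the lifting of a local `m`-joint invariant `f` through
the projection `M ^ k → M ^ m` that keeps, in their order, the components selected by `σ`. -/
def IsLiftedInvariant (m : ℕ) {k : ℕ} (O : Set (Fin k → M)) (h : (Fin k → M) → ℝ) : Prop :=
  ∃ (σ : Fin m ↪o Fin k) (V : Set (Fin m → M)) (f : (Fin m → M) → ℝ),
    IsOpen V ∧ IsLocalJointInvariant E G V f ∧ ∀ q ∈ O, q ∘ σ ∈ V ∧ h q = f (q ∘ σ)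

/-- Near the `k`-tuple `p`, the function `I` depends functionally on finitely many liftings `h j`
of local `m`-joint invariants: `I` is a smooth function of the `h j`, and the differential of `I`
is a combination of the differentials of the `h j` with smooth functions as coefficients. -/
def FunctionallyDependentAt (m : ℕ) {k : ℕ} (I : (Fin k → M) → ℝ) (p : Fin k → M) : Prop :=
  ∃ (O : Set (Fin k → M)) (n : ℕ) (h : Fin n → (Fin k → M) → ℝ),
    IsOpen O ∧ p ∈ O ∧ (∀ j, IsLiftedInvariant E G m O (h j)) ∧
    (∃ (D : Set (Fin n → ℝ)) (Φ : (Fin n → ℝ) → ℝ), IsOpen D ∧ ContDiffOn ℝ ∞ Φ D ∧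
      ∀ q ∈ O, (fun j => h j q) ∈ D ∧ I q = Φ fun j => h j q) ∧
    (∃ c : Fin n → (Fin k → M) → ℝ,
      (∀ j, ContMDiffOn (powModel E k) 𝓘(ℝ, ℝ) ∞ (c j) O) ∧
      ∀ q ∈ O, mvfderiv (powModel E k) I q = ∑ j, c j q • mvfderiv (powModel E k) (h j) q)

end Invariants

end

end JointInvariants

/-! The local rank is finite by a dimension count: while the stabilizer algebra of a tuple is
nonzero, local faithfulness provides, in any nonempty open set, a further point that strictly
shrinks it, so `dim G` points suffice generically.

Near a locally regular `k₀`-tuple the infinitesimal action is injective, and the implicit function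
theorem yields a local moving frame `ρ` with `ρ (g • x) = ρ x * g⁻¹`
(`LocallyRegular.exists_isMovingFrameOn`). If `ρ` is evaluated on the first `k₀` components of a
`k`-tuple `q`, each `ρ • q i` is invariant and depends on at most `k₀ + 1` points. Normalize `ρ = 1`
at the given tuple. An invariant `I` then satisfies `I q = I (ρ • q)` nearby, so it is a smooth
function of the coordinates of the points `ρ • q i` (`IsMovingFrameOn.functionallyDependentAt`).
Hence `k₁ = k₀ + 1` works, and the chain rule gives the relation between differentials. -/

namespace JointInvariants

/-! ### Finiteness of the local rank. -/

section LocalRank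

variable {F : Type*} [NormedAddCommGroup F] [NormedSpace ℝ F]
  {E : Type*} [NormedAddCommGroup E] [NormedSpace ℝ E]
  {G : Type*} [TopologicalSpace G] [ChartedSpace F G] [Group G]
  {M : Type*} [TopologicalSpace M] [ChartedSpace E M] [MulAction G M]

theorem estTuple_cons {k : ℕ} (a : M) (x : Fin k → M) :
    estTuple F E G (Fin.cons a x : Fin (k + 1) → M) = est F E G a ⊓ estTuple F E G x := by
  simp only [estTuple]
  apply le_antisymm
  · exact le_inf (iInf_le_of_le 0 le_rfl) (le_iInf fun i => iInf_le_of_le i.succ le_rfl)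
  · refine le_iInf fun i => ?_
    induction i using Fin.cases with
    | zero => exact inf_le_left
    | succ i => exact inf_le_right.trans (iInf_le _ i)

theorem finiteDimensional_groupLieAlgebra [FiniteDimensional ℝ F] :
    FiniteDimensional ℝ (GroupLieAlgebra 𝓘(ℝ, F) G) :=
  inferInstanceAs (FiniteDimensional ℝ F)

/-- In every box of `k`-tuples there is a locally regular tuple, or one for which the dimension of
the stabilizer has dropped by at least `k`. -/
theorem exists_mem_estTuple_eq_bot_or_finrank_add_le [FiniteDimensional ℝ F]
    (h : LocallyFaithful F E G M) (k : ℕ) (s : Fin k → Set M) (hs : ∀ i, IsOpen (s i))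
    (hne : ∀ i, (s i).Nonempty) :
    ∃ x : Fin k → M, (∀ i, x i ∈ s i) ∧ (estTuple F E G x = ⊥ ∨
      Module.finrank ℝ (estTuple F E G x) + k ≤
        Module.finrank ℝ (GroupLieAlgebra 𝓘(ℝ, F) G)) := by
  have : FiniteDimensional ℝ (GroupLieAlgebra 𝓘(ℝ, F) G) := finiteDimensional_groupLieAlgebra
  induction k with
  | zero => exact ⟨Fin.elim0, fun i => i.elim0, Or.inr (Submodule.finrank_le _)⟩
  | succ k ih =>
    obtain ⟨x, hxs, hx⟩ := ih (fun i => s i.succ) (fun i => hs _) (fun i => hne _)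
    have key : ∀ a ∈ s 0, ∀ i, (Fin.cons a x : Fin (k + 1) → M) i ∈ s i := by
      intro a ha i
      induction i using Fin.cases with
      | zero => exact ha
      | succ i => exact hxs i
    by_cases hbot : estTuple F E G x = ⊥
    · obtain ⟨a, ha⟩ := hne 0
      exact ⟨Fin.cons a x, key a ha, Or.inl (by rw [estTuple_cons, hbot, inf_bot_eq])⟩
    -- A nonzero `X` in the stabilizer cannot vanish on all of `s 0`; a point where it does not
    -- vanish lowers the dimension by at least one.
    · obtain ⟨X, hX, hX0⟩ := Submodule.exists_mem_ne_zero_of_ne_bot hbot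
      obtain ⟨a, ha, haX⟩ : ∃ a ∈ s 0, ig F E G a X ≠ 0 := by
        by_contra! hcon
        refine hX0 (h (s 0) (hs 0) (hne 0) ?_)
        funext p
        simpa using hcon p p.2
      refine ⟨Fin.cons a x, key a ha, Or.inr ?_⟩
      have hlt : est F E G a ⊓ estTuple F E G x < estTuple F E G x := by
        refine lt_of_le_of_ne inf_le_right fun heq => haX ?_
        exact (heq.ge hX).1
      have := Submodule.finrank_lt_finrank_of_lt hlt
      rw [estTuple_cons]
      have := hx.resolve_left hbot
      omega

theorem genericallyLocallyRegular_finrank [FiniteDimensional ℝ F]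
    (h : LocallyFaithful F E G M) :
    GenericallyLocallyRegular F E G M (Module.finrank ℝ (GroupLieAlgebra 𝓘(ℝ, F) G)) := by
  have : FiniteDimensional ℝ (GroupLieAlgebra 𝓘(ℝ, F) G) := finiteDimensional_groupLieAlgebra
  refine dense_iff_inter_open.2 fun U hU ⟨q, hq⟩ => ?_
  obtain ⟨u, hu, huU⟩ := isOpen_pi_iff'.1 hU q hq
  obtain ⟨x, hxu, hx⟩ := exists_mem_estTuple_eq_bot_or_finrank_add_le h _ u
    (fun i => (hu i).1) (fun i => ⟨_, (hu i).2⟩)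
  refine ⟨x, huU fun i _ => hxu i, ?_⟩
  rcases hx with hx | hx
  · exact hx
  · exact Submodule.finrank_eq_zero.1 (by omega)

theorem exists_isLocalRank [FiniteDimensional ℝ F] (h : LocallyFaithful F E G M) :
    ∃ k₀, IsLocalRank F E G M k₀ := by
  classical
  have hex : ∃ k, GenericallyLocallyRegular F E G M k := ⟨_, genericallyLocallyRegular_finrank h⟩
  exact ⟨Nat.find hex, Nat.find_spec hex, fun k hk => Nat.find_min' hex hk⟩

end LocalRank

/-! ### Smoothness into and out of the power `M ^ k`. -/

section Pi

variable {E : Type*} [NormedAddCommGroup E] [NormedSpace ℝ E]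
  {M : Type*} [TopologicalSpace M] [ChartedSpace E M]
  {E' : Type*} [NormedAddCommGroup E'] [NormedSpace ℝ E']
  {H : Type*} [TopologicalSpace H] {J : ModelWithCorners ℝ E' H}
  {N : Type*} [TopologicalSpace N] [ChartedSpace H N] {n : ℕ∞ω} {k : ℕ}

/-- The charts of the power act componentwise by definition, so this reduces to the vector space
statement. -/
theorem contMDiffWithinAt_pow {f : N → Fin k → M} {s : Set N} {x : N} :
    ContMDiffWithinAt J (powModel E k) n f s x ↔
      ∀ i, ContMDiffWithinAt J 𝓘(ℝ, E) n (fun z => f z i) s x := by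
  simp only [contMDiffWithinAt_iff, continuousWithinAt_pi, forall_and]
  refine and_congr Iff.rfl ?_
  rw [contDiffWithinAt_pi]
  rfl

theorem contMDiffOn_pow {f : N → Fin k → M} {s : Set N} :
    ContMDiffOn J (powModel E k) n f s ↔ ∀ i, ContMDiffOn J 𝓘(ℝ, E) n (fun z => f z i) s :=
  ⟨fun h i x hx => contMDiffWithinAt_pow.1 (h x hx) i,
    fun h x hx => contMDiffWithinAt_pow.2 fun i => h i x hx⟩

theorem contMDiff_pow {f : N → Fin k → M} :
    ContMDiff J (powModel E k) n f ↔ ∀ i, ContMDiff J 𝓘(ℝ, E) n (fun z => f z i) := by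
  simp only [← contMDiffOn_univ, contMDiffOn_pow]

theorem contMDiff_pow_apply (i : Fin k) :
    ContMDiff (powModel E k) 𝓘(ℝ, E) n (fun q : Fin k → M => q i) := by
  intro p
  refine contMDiffAt_iff.2 ⟨continuousAt_apply i p, ?_⟩
  have h : ContDiffWithinAt ℝ n (fun y : Fin k → E => y i) (Set.range (powModel E k))
      (extChartAt (powModel E k) p p) := (contDiff_apply ℝ E i).contDiffWithinAt
  refine h.congr_of_eventuallyEq ?_ ?_
  · filter_upwards [extChartAt_target_mem_nhdsWithin (I := powModel E k) p] with y hy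
    exact congrFun ((extChartAt (powModel E k) p).right_inv hy) i
  · exact congrFun ((extChartAt (powModel E k) p).right_inv (mem_extChartAt_target p)) i

theorem contMDiff_pow_comp {m : ℕ} (σ : Fin m → Fin k) :
    ContMDiff (powModel E k) (powModel E m) n (fun q : Fin k → M => q ∘ σ) :=
  contMDiff_pow.2 fun i => contMDiff_pow_apply (σ i)

end Pi

/-! ### A smooth implicit function theorem. -/

section ImplicitFunction

/-- The implicit function theorem for smooth functions, on open sets. -/
theorem exists_implicit_function_contDiffOn
    {F : Type*} [NormedAddCommGroup F] [NormedSpace ℝ F] [CompleteSpace F]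
    {E : Type*} [NormedAddCommGroup E] [NormedSpace ℝ E] [CompleteSpace E]
    {Ω : Set (F × E)} (hΩ : IsOpen Ω) {Ψ : F × E → F} (hΨ : ContDiffOn ℝ ∞ Ψ Ω)
    {a : F} {b : E} (hab : (a, b) ∈ Ω)
    (hderiv : HasFDerivAt (fun u => Ψ (u, b)) (ContinuousLinearMap.id ℝ F) a) :
    ∃ (A : Set (F × E)) (B : Set E) (r : E → F), IsOpen A ∧ A ⊆ Ω ∧
      Set.InjOn (fun z : F × E => (Ψ z, z.2)) A ∧ IsOpen B ∧ b ∈ B ∧ ContDiffOn ℝ ∞ r B ∧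
      ∀ y ∈ B, (r y, y) ∈ A ∧ Ψ (r y, y) = Ψ (a, b) := by
  set T : F × E → F × E := fun z => (Ψ z, z.2) with hT
  have hTs : ∀ z ∈ Ω, ContDiffAt ℝ ∞ T z := fun z hz =>
    (hΨ.contDiffAt (hΩ.mem_nhds hz)).prodMk contDiffAt_snd
  have hΨd := ((hΨ.contDiffAt (hΩ.mem_nhds hab)).differentiableAt (by simp)).hasFDerivAt
  set Q := fderiv ℝ Ψ (a, b) with hQ
  have hQ1 : ∀ u, Q (u, 0) = u := by
    intro u
    have h1 : HasFDerivAt (fun u => Ψ (u, b)) (Q.comp (ContinuousLinearMap.inl ℝ F E)) a :=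
      HasFDerivAt.comp a hΨd (hasFDerivAt_prodMk_left a b)
    have := congrArg (fun l : F →L[ℝ] F => l u) (h1.unique hderiv)
    simpa using this
  have hQ2 : ∀ u v, Q (u, v) = u + Q (0, v) := by
    intro u v
    have : ((u, v) : F × E) = (u, 0) + (0, v) := by simp
    rw [this, map_add, hQ1]
  -- The derivative `(u, v) ↦ (u + Q (0, v), v)` of `T` is unipotent, with inverse `(u, v) ↦ (u - Q
  -- (0, v), v)`.
  let T' : (F × E) ≃L[ℝ] (F × E) := ContinuousLinearEquiv.equivOfInverse
    (Q.prod (ContinuousLinearMap.snd ℝ F E))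
    ((ContinuousLinearMap.fst ℝ F E - (Q.comp (ContinuousLinearMap.inr ℝ F E)).comp
      (ContinuousLinearMap.snd ℝ F E)).prod (ContinuousLinearMap.snd ℝ F E))
    (by rintro ⟨u, v⟩; simp [hQ2 u v]) (by rintro ⟨u, v⟩; simp [hQ2 (u - _) v])
  have hTd : HasFDerivAt T (T' : (F × E) →L[ℝ] (F × E)) (a, b) :=
    hΨd.prodMk hasFDerivAt_snd
  let e := (hTs _ hab).toOpenPartialHomeomorph T hTd (by simp)
  have habe : (a, b) ∈ e.source :=
    (hTs _ hab).mem_toOpenPartialHomeomorph_source hTd (by simp)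
  have hcont : ContinuousOn (fderiv ℝ T) Ω := by
    intro z hz
    exact (((hTs z hz).fderiv_right (m := 0) (by simp)).continuousAt).continuousWithinAt
  set R : Set ((F × E) →L[ℝ] (F × E)) :=
    Set.range ((↑) : ((F × E) ≃L[ℝ] (F × E)) → ((F × E) →L[ℝ] (F × E))) with hR
  have hRo : IsOpen R := ContinuousLinearEquiv.isOpen
  -- Keeping only the points where the derivative of `T` is invertible makes the local inverse
  -- smooth on all of `e '' A`, not just at the base point.
  set A : Set (F × E) := e.source ∩ (Ω ∩ fderiv ℝ T ⁻¹' R) with hA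
  have hAo : IsOpen A := e.open_source.inter (hcont.isOpen_inter_preimage hΩ hRo)
  have habA : (a, b) ∈ A := ⟨habe, hab, T', hTd.fderiv.symm⟩
  have hBo : IsOpen (e '' A) := e.isOpen_image_of_subset_source hAo Set.inter_subset_left
  refine ⟨A, (fun y => (Ψ (a, b), y)) ⁻¹' (e '' A), fun y => (e.symm (Ψ (a, b), y)).1, hAo,
    fun z hz => hz.2.1, fun z hz w hw hzw => e.injOn hz.1 hw.1 hzw, hBo.preimage (by fun_prop),
    ⟨(a, b), habA, rfl⟩, ?_, ?_⟩
  · intro y hy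
    obtain ⟨z, hz, hzy : e z = (Ψ (a, b), y)⟩ := hy
    have hzy' : e.symm (Ψ (a, b), y) = z := by rw [← hzy, e.left_inv hz.1]
    obtain ⟨f', hf'⟩ := hz.2.2
    have hsymm : ContDiffAt ℝ ∞ e.symm (Ψ (a, b), y) := by
      refine e.contDiffAt_symm (f₀' := f') ?_ ?_ ?_
      · rw [← hzy]; exact e.map_source hz.1
      · rw [hzy', hf']
        exact ((hTs z hz.2.1).differentiableAt (by simp)).hasFDerivAt
      · rw [hzy']; exact hTs z hz.2.1
    have : ContDiffAt ℝ ∞ (fun y : E => (Ψ (a, b), y)) y := by fun_prop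
    exact ((hsymm.comp y this).fst).contDiffWithinAt
  · rintro y ⟨z, hz, hzy : e z = (Ψ (a, b), y)⟩
    have hzy' : e.symm (Ψ (a, b), y) = z := by rw [← hzy, e.left_inv hz.1]
    have h1 : Ψ z = Ψ (a, b) := congrArg Prod.fst hzy
    have h2 : z.2 = y := congrArg Prod.snd hzy
    have h3 : ((e.symm (Ψ (a, b), y)).1, y) = z := by rw [hzy', ← h2]
    simp only [h3]
    exact ⟨hz, h1⟩

end ImplicitFunction

end JointInvariants

namespace JointInvariants

/-! ### Construction of local moving frames. -/

section MovingFrame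

variable (F : Type*) [NormedAddCommGroup F] [NormedSpace ℝ F]
  (E : Type*) [NormedAddCommGroup E] [NormedSpace ℝ E]
  {G : Type*} [TopologicalSpace G] [ChartedSpace F G] [Group G]
  {M : Type*} [TopologicalSpace M] [ChartedSpace E M] [MulAction G M]

/-- A local moving frame for the diagonal action on `k`-tuples: a smooth map to the group, defined
on an open set and equivariant for the right action by inverses, near the identity. -/
structure IsMovingFrameOn {k : ℕ} (S : Set (Fin k → M)) (ρ : (Fin k → M) → G) : Prop where
  isOpen : IsOpen S
  smooth : ContMDiffOn (powModel E k) 𝓘(ℝ, F) ∞ ρ S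
  equivariant : ∀ x ∈ S, ∀ᶠ g in 𝓝 (1 : G), ρ (g • x) = ρ x * g⁻¹

variable {F E}

/-- Left translations commute with the right action; this allows a frame to be normalized to `1` at
a chosen tuple. -/
theorem IsMovingFrameOn.const_mul [LieGroup 𝓘(ℝ, F) ∞ G] {k : ℕ} {S : Set (Fin k → M)}
    {ρ : (Fin k → M) → G} (h : IsMovingFrameOn F E S ρ) (a : G) :
    IsMovingFrameOn F E S fun x => a * ρ x where
  isOpen := h.isOpen
  smooth := contMDiffOn_const.mul h.smooth
  equivariant x hx := by
    filter_upwards [h.equivariant x hx] with g hg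
    rw [hg, mul_assoc]

variable (F E G) in
/-- The infinitesimal generators at `p`, as a linear map between the model spaces. -/
noncomputable def igModel (p : M) : F →L[ℝ] E := ig F E G p

theorem LocallyRegular.eq_zero_of_forall_ig_eq_zero {k : ℕ} {p : Fin k → M}
    (hp : LocallyRegular F E G p) {X : GroupLieAlgebra 𝓘(ℝ, F) G}
    (hX : ∀ i, ig F E G (p i) X = 0) : X = 0 := by
  have h : X ∈ estTuple F E G p := (Submodule.mem_iInf _).2 hX
  rwa [show estTuple F E G p = ⊥ from hp, Submodule.mem_bot] at h

theorem hasFDerivAt_orbit_extChartAt [ContMDiffSMul 𝓘(ℝ, F) 𝓘(ℝ, E) ∞ G M] (p : M) :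
    HasFDerivAt (fun u : F => extChartAt 𝓘(ℝ, E) p ((extChartAt 𝓘(ℝ, F) (1 : G)).symm u • p))
      (igModel F E G p) (extChartAt 𝓘(ℝ, F) (1 : G) 1) := by
  have hs : ContMDiff 𝓘(ℝ, F) 𝓘(ℝ, E) ∞ (fun g : G => g • p) :=
    contMDiff_id.smul contMDiff_const
  have h := ((hs 1).mdifferentiableAt (by simp)).hasMFDerivAt.2
  have h' : HasFDerivAt (extChartAt 𝓘(ℝ, E) ((1 : G) • p) ∘ (fun g : G => g • p) ∘
      (extChartAt 𝓘(ℝ, F) (1 : G)).symm) (igModel F E G p)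
      (extChartAt 𝓘(ℝ, F) (1 : G) 1) := by
    have hr : Set.range 𝓘(ℝ, F) = Set.univ := ModelWithCorners.range_eq_univ _
    rw [hr] at h
    exact hasFDerivWithinAt_univ.1 h
  rwa [one_smul] at h'

variable [LieGroup 𝓘(ℝ, F) ∞ G] [IsManifold 𝓘(ℝ, E) ∞ M] [ContMDiffSMul 𝓘(ℝ, F) 𝓘(ℝ, E) ∞ G M]

/-- Near a locally regular tuple there is a local moving frame. -/
theorem LocallyRegular.exists_isMovingFrameOn [FiniteDimensional ℝ F] [FiniteDimensional ℝ E]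
    {k : ℕ} {p : Fin k → M} (hp : LocallyRegular F E G p) :
    ∃ (S : Set (Fin k → M)) (ρ : (Fin k → M) → G), p ∈ S ∧ IsMovingFrameOn F E S ρ := by
  have : IsTopologicalGroup G := topologicalGroup_of_lieGroup 𝓘(ℝ, F) ∞
  have : ContinuousSMul G M := ContMDiffSMul.continuousSMul (I := 𝓘(ℝ, F)) (I' := 𝓘(ℝ, E)) ∞
  have : CompleteSpace F := FiniteDimensional.complete ℝ F
  have : CompleteSpace E := FiniteDimensional.complete ℝ E
  -- Regularity makes the map from `X` to its generators at the `p i` injective; its left inverse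
  -- `L` selects as many equations as `G` has dimensions.
  obtain ⟨L, hL⟩ : ∃ L : (Fin k → E) →L[ℝ] F,
      L.comp (ContinuousLinearMap.pi fun i => igModel F E G (p i)) =
        ContinuousLinearMap.id ℝ F := by
    obtain ⟨L, hL⟩ := LinearMap.exists_leftInverse_of_injective
      (ContinuousLinearMap.pi fun i => igModel F E G (p i)).toLinearMap (by
        refine (Submodule.eq_bot_iff _).2 fun X hX => ?_
        exact hp.eq_zero_of_forall_ig_eq_zero (X := X) fun i => congrFun hX i)
    exact ⟨LinearMap.toContinuousLinearMap L, ContinuousLinearMap.ext fun X =>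
      congrArg (fun l => l X) hL⟩
  set ψ := extChartAt 𝓘(ℝ, F) (1 : G) with hψ
  let φ : ∀ i, PartialEquiv M E := fun i => extChartAt 𝓘(ℝ, E) (p i)
  let θ : (Fin k → M) → Fin k → E := fun q i => φ i (q i)
  set V : Set (Fin k → M) := Set.univ.pi fun i => (φ i).source with hV
  have hVo : IsOpen V := isOpen_set_pi Set.finite_univ fun i _ => isOpen_extChartAt_source _
  have hθs : ContMDiffOn (powModel E k) 𝓘(ℝ, Fin k → E) ∞ θ V := by
    refine contMDiffOn_pi_space.2 fun i => ?_
    refine ((contMDiffOn_extChartAt (I := 𝓘(ℝ, E)) (x := p i)).comp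
      (contMDiff_pow_apply i).contMDiffOn fun q hq => ?_)
    rw [← extChartAt_source 𝓘(ℝ, E)]
    exact hq i trivial
  -- The action, with both arguments read in charts. The frame will be the solution `g = ρ x` of `L
  -- (θ (g • x)) = L (θ p)`.
  let α : F × (Fin k → E) → Fin k → M := fun z i => ψ.symm z.1 • (φ i).symm (z.2 i)
  set Ω₀ : Set (F × (Fin k → E)) := ψ.target ×ˢ Set.univ.pi fun i => (φ i).target with hΩ₀
  have hΩ₀o : IsOpen Ω₀ := (isOpen_extChartAt_target _).prod
    (isOpen_set_pi Set.finite_univ fun i _ => isOpen_extChartAt_target _)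
  have hαs : ∀ i, ContMDiffOn 𝓘(ℝ, F × (Fin k → E)) 𝓘(ℝ, E) ∞ (fun z => α z i) Ω₀ := by
    intro i
    have h1 : ContMDiffOn 𝓘(ℝ, F × (Fin k → E)) 𝓘(ℝ, F) ∞
        (fun z : F × (Fin k → E) => ψ.symm z.1) Ω₀ :=
      (contMDiffOn_extChartAt_symm (1 : G)).comp
        (contDiff_fst.contMDiff.contMDiffOn) fun z hz => hz.1
    have h2 : ContMDiffOn 𝓘(ℝ, F × (Fin k → E)) 𝓘(ℝ, E) ∞
        (fun z : F × (Fin k → E) => (φ i).symm (z.2 i)) Ω₀ :=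
      (contMDiffOn_extChartAt_symm (p i)).comp
        (((contDiff_apply ℝ E i).comp contDiff_snd).contMDiff.contMDiffOn)
        fun z hz => hz.2 i trivial
    exact h1.smul h2
  have hαc : ContinuousOn α Ω₀ := continuousOn_pi.2 fun i => (hαs i).continuousOn
  set Ω : Set (F × (Fin k → E)) := Ω₀ ∩ α ⁻¹' V with hΩ
  have hΩo : IsOpen Ω := hαc.isOpen_inter_preimage hΩ₀o hVo
  have hΨs : ContDiffOn ℝ ∞ (fun z => L (θ (α z))) Ω := by
    refine L.contDiff.comp_contDiffOn (contMDiffOn_iff_contDiffOn.1 ?_)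
    exact hθs.comp ((contMDiffOn_pow.2 hαs).mono Set.inter_subset_left) fun z hz => hz.2
  have hθp : ∀ i, (φ i).symm (θ p i) = p i := fun i => extChartAt_to_inv (p i)
  have hψ1 : ψ.symm (ψ 1) = 1 := extChartAt_to_inv 1
  have hab : (ψ 1, θ p) ∈ Ω := by
    refine ⟨⟨mem_extChartAt_target _, fun i _ => mem_extChartAt_target _⟩, fun i _ => ?_⟩
    simp only [α, hθp, hψ1, one_smul]
    exact mem_extChartAt_source _
  obtain ⟨A, B, r, hAo, hAΩ, hinj, hBo, hpB, hr, hrA⟩ :=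
    exists_implicit_function_contDiffOn hΩo hΨs hab (by
      rw [← hL]
      refine L.hasFDerivAt.comp _ (hasFDerivAt_pi.2 fun i => ?_)
      simp only [α, hθp]
      exact hasFDerivAt_orbit_extChartAt (p i))
  have hSo : IsOpen (V ∩ θ ⁻¹' B) := hθs.continuousOn.isOpen_inter_preimage hVo hBo
  refine ⟨V ∩ θ ⁻¹' B, fun q => ψ.symm (r (θ q)),
    ⟨fun i _ => mem_extChartAt_source _, hpB⟩, hSo, ?_, ?_⟩
  · refine (contMDiffOn_extChartAt_symm (1 : G)).comp
      (hr.contMDiffOn.comp (hθs.mono Set.inter_subset_left) fun q hq => hq.2) fun q hq => ?_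
    exact (hAΩ (hrA _ hq.2).1).1.1
  · intro q hq
    have hrt : r (θ q) ∈ ψ.target := (hAΩ (hrA _ hq.2).1).1.1
    have hαe : ∀ g ∈ ψ.source, ∀ x ∈ V, α (ψ g, θ x) = g • x := by
      intro g hg x hx
      funext i
      simp only [α, θ, ψ.left_inv hg, (φ i).left_inv (hx i trivial), Pi.smul_apply]
    have c1 : Filter.Tendsto (fun g : G => ψ.symm (r (θ q)) * g⁻¹) (𝓝 1)
        (𝓝 (ψ.symm (r (θ q)))) := by
      have : Continuous fun g : G => ψ.symm (r (θ q)) * g⁻¹ := by fun_prop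
      simpa using this.tendsto 1
    have c2 : Filter.Tendsto (fun g : G => g • q) (𝓝 1) (𝓝 q) := by
      have : Continuous fun g : G => g • q := by fun_prop
      simpa using this.tendsto 1
    have hsrc : ψ.symm (r (θ q)) ∈ ψ.source := ψ.map_target hrt
    have c3 : Filter.Tendsto (fun g : G => (ψ (ψ.symm (r (θ q)) * g⁻¹), θ (g • q))) (𝓝 1)
        (𝓝 (r (θ q), θ q)) := by
      refine Filter.Tendsto.prodMk_nhds ?_
        ((hθs.continuousOn.continuousAt (hVo.mem_nhds hq.1)).tendsto.comp c2)
      have := ((continuousAt_extChartAt' hsrc).tendsto.comp c1)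
      rwa [← hψ, ψ.right_inv hrt] at this
    filter_upwards [c3 (hAo.mem_nhds (hrA _ hq.2).1), c2 (hSo.mem_nhds hq),
      c1 ((isOpen_extChartAt_source (I := 𝓘(ℝ, F)) (1 : G)).mem_nhds hsrc)] with g hg1 hg2 hg3
    -- Both `ρ q * g⁻¹` and `ρ (g • q)` solve the defining equation at `g • q`, since the former
    -- moves `g • q` to `ρ q • q`. For `g` near `1` both lie in `A`, where the solution is unique.
    have e1 : α (ψ (ψ.symm (r (θ q)) * g⁻¹), θ (g • q)) = ψ.symm (r (θ q)) • q := by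
      rw [hαe _ hg3 _ hg2.1, smul_smul, inv_mul_cancel_right]
    have e2 : α (r (θ q), θ q) = ψ.symm (r (θ q)) • q := by
      have := hαe _ hsrc _ hq.1
      rwa [ψ.right_inv hrt] at this
    have e3 := hinj hg1 (hrA _ hg2.2).1 (by
      refine Prod.ext ?_ rfl
      change L (θ _) = L (θ _)
      rw [(hrA _ hg2.2).2, e1, ← e2, (hrA _ hq.2).2])
    have e4 := congrArg (fun z => ψ.symm z.1) e3
    rw [← e4]
    exact ψ.left_inv hg3

end MovingFrame

end JointInvariants

namespace JointInvariants

/-! ### From functional dependence to dependence of differentials. -/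

section ChainRule

variable {E : Type*} [NormedAddCommGroup E] [NormedSpace ℝ E]
  {H : Type*} [TopologicalSpace H] {J : ModelWithCorners ℝ E H}
  {N : Type*} [TopologicalSpace N] [ChartedSpace H N]

/-- If `I` is a smooth function of the smooth functions `h j`, then its differential is a
combination of their differentials with smooth coefficients. -/
theorem exists_mvfderiv_eq_sum {O : Set N} (hO : IsOpen O) {n : ℕ} {h : Fin n → N → ℝ}
    (hh : ∀ j, ContMDiffOn J 𝓘(ℝ, ℝ) ∞ (h j) O) {D : Set (Fin n → ℝ)} (hD : IsOpen D)
    {Φ : (Fin n → ℝ) → ℝ} (hΦ : ContDiffOn ℝ ∞ Φ D) {I : N → ℝ}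
    (hI : ∀ q ∈ O, (fun j => h j q) ∈ D ∧ I q = Φ fun j => h j q) :
    ∃ c : Fin n → N → ℝ, (∀ j, ContMDiffOn J 𝓘(ℝ, ℝ) ∞ (c j) O) ∧
      ∀ q ∈ O, mvfderiv J I q = ∑ j, c j q • mvfderiv J (h j) q := by
  have hvec : ContMDiffOn J 𝓘(ℝ, Fin n → ℝ) ∞ (fun q j => h j q) O := contMDiffOn_pi_space.2 hh
  refine ⟨fun j q => fderiv ℝ Φ (fun j => h j q) (Pi.single j 1), fun j => ?_, fun q hq => ?_⟩
  · have h1 : ContDiffOn ℝ ∞ (fun t => fderiv ℝ Φ t (Pi.single j 1)) D :=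
      (hΦ.fderiv_of_isOpen hD (m := ∞) (by simp)).clm_apply contDiffOn_const
    exact h1.contMDiffOn.comp hvec fun q hq => (hI q hq).1
  · have hd : MDifferentiableAt J 𝓘(ℝ, Fin n → ℝ) (fun q j => h j q) q :=
      ((hvec q hq).contMDiffAt (hO.mem_nhds hq)).mdifferentiableAt (by simp)
    have hΦd : DifferentiableAt ℝ Φ (fun j => h j q) :=
      (hΦ.contDiffAt (hD.mem_nhds (hI q hq).1)).differentiableAt (by simp)
    have heq : I =ᶠ[𝓝 q] Φ ∘ fun q j => h j q :=
      Filter.eventuallyEq_of_mem (hO.mem_nhds hq) fun q hq => (hI q hq).2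
    have h1 : HasMFDerivAt J 𝓘(ℝ, ℝ) I q
        ((fderiv ℝ Φ fun j => h j q).comp (mvfderiv J (fun q j => h j q) q)) :=
      (HasMFDerivAt.comp q hΦd.hasFDerivAt.hasMFDerivAt hd.hasMFDerivAt).congr_of_eventuallyEq heq
    have h2 : ∀ j, HasMFDerivAt J 𝓘(ℝ, ℝ) (h j) q
        ((ContinuousLinearMap.proj (R := ℝ) (φ := fun _ : Fin n => ℝ) j).comp
          (mvfderiv J (fun q j => h j q) q)) := fun j =>
      HasMFDerivAt.comp (f := fun q j => h j q) q (ContinuousLinearMap.hasMFDerivAt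
        (ContinuousLinearMap.proj (R := ℝ) (φ := fun _ : Fin n => ℝ) j)) hd.hasMFDerivAt
    have e1 : mvfderiv J I q =
        (fderiv ℝ Φ fun j => h j q).comp (mvfderiv J (fun q j => h j q) q) := h1.mfderiv
    have e2 : ∀ j, mvfderiv J (h j) q =
        (ContinuousLinearMap.proj (R := ℝ) (φ := fun _ : Fin n => ℝ) j).comp
          (mvfderiv J (fun q j => h j q) q) := fun j => (h2 j).mfderiv
    rw [e1]
    simp only [e2]
    ext v
    generalize mvfderiv J (fun q j => h j q) q = T
    simp only [ContinuousLinearMap.comp_apply, sum_apply,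
      smul_apply, ContinuousLinearMap.proj_apply, smul_eq_mul]
    conv_lhs => rw [pi_eq_sum_univ' (T v), map_sum]
    refine Finset.sum_congr rfl fun j _ => ?_
    rw [map_smul, smul_eq_mul, mul_comm]

end ChainRule

/-! ### Invariantization and the reduction to fewer points. -/

section Invariants

variable {F : Type*} [NormedAddCommGroup F] [NormedSpace ℝ F]
  {E : Type*} [NormedAddCommGroup E] [NormedSpace ℝ E]
  {G : Type*} [TopologicalSpace G] [ChartedSpace F G] [Group G]
  {M : Type*} [TopologicalSpace M] [ChartedSpace E M] [MulAction G M]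

/-- A local joint invariant is constant along the pieces of orbits obtained from a neighbourhood
of the identity which is uniform near a given tuple. -/
theorem IsLocalJointInvariant.exists_nhds_apply_smul_eq [IsTopologicalGroup G]
    [LocallyConnectedSpace G] [ContinuousSMul G M] {k : ℕ} {U : Set (Fin k → M)}
    {I : (Fin k → M) → ℝ} (hU : IsOpen U) (hI : IsLocalJointInvariant E G U I) {p : Fin k → M}
    (hp : p ∈ U) :
    ∃ (A : Set G) (O : Set (Fin k → M)), IsOpen A ∧ 1 ∈ A ∧ IsOpen O ∧ p ∈ O ∧
      ∀ g ∈ A, ∀ q ∈ O, g • q ∈ U ∧ I (g • q) = I q := by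
  have hc : Continuous fun z : G × (Fin k → M) => z.1 • z.2 := by fun_prop
  have hmem : (fun z : G × (Fin k → M) => z.1 • z.2) ⁻¹' U ∈ 𝓝 ((1 : G), p) :=
    (hU.preimage hc).mem_nhds (by simpa using hp)
  obtain ⟨A₀, hA₀, O₀, hO₀, hsub⟩ := mem_nhds_prod_iff.1 hmem
  -- The neighbourhood in the definition of invariance depends on the tuple. On a connected `A`,
  -- local constancy of `g ↦ I (g • q)` becomes constancy, with the same `A` for all `q` in `O`.
  obtain ⟨A, hAA, hAo, h1A, hAc⟩ :=
    locallyConnectedSpace_iff_subsets_isOpen_isConnected.1 ‹_› (1 : G) A₀ hA₀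
  obtain ⟨O, hOO, hOo, hpO⟩ := mem_nhds_iff.1 hO₀
  have hmaps : ∀ g ∈ A, ∀ q ∈ O, g • q ∈ U := fun g hg q hq =>
    hsub (Set.mk_mem_prod (hAA hg) (hOO hq))
  refine ⟨A, O, hAo, h1A, hOo, hpO, fun g hg q hq => ⟨hmaps g hg q hq, ?_⟩⟩
  have : PreconnectedSpace A := isPreconnected_iff_preconnectedSpace.1 hAc.isPreconnected
  have hloc : IsLocallyConstant fun a : A => I ((a : G) • q) := by
    refine (IsLocallyConstant.iff_eventually_eq _).2 fun a => ?_
    have ht : Filter.Tendsto (fun b : A => (b : G) * (a : G)⁻¹) (𝓝 a) (𝓝 1) := by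
      have : Continuous fun b : A => (b : G) * (a : G)⁻¹ := by fun_prop
      simpa using this.tendsto a
    filter_upwards [ht.eventually (hI.locallyConstant _ (hmaps a a.2 q hq))] with b hb
    simpa [smul_smul] using hb
  simpa using hloc.apply_eq_of_preconnectedSpace ⟨g, hg⟩ ⟨1, h1A⟩

variable [ContMDiffSMul 𝓘(ℝ, F) 𝓘(ℝ, E) ∞ G M]

/-- Invariantization: a function of one component, moved by a moving frame that depends on some of
the components, is a local joint invariant. -/
theorem IsMovingFrameOn.isLocalJointInvariant {m k : ℕ} {S : Set (Fin m → M)}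
    {ρ : (Fin m → M) → G} (hρ : IsMovingFrameOn F E S ρ) (c : Fin m → Fin k) (t : Fin k)
    {T : Set M} (hT : IsOpen T) {u : M → ℝ} (hu : ContMDiffOn 𝓘(ℝ, E) 𝓘(ℝ, ℝ) ∞ u T) :
    IsOpen {x : Fin k → M | x ∘ c ∈ S ∧ ρ (x ∘ c) • x t ∈ T} ∧
      IsLocalJointInvariant E G {x : Fin k → M | x ∘ c ∈ S ∧ ρ (x ∘ c) • x t ∈ T}
        fun x => u (ρ (x ∘ c) • x t) := by
  have hs : ContMDiffOn (powModel E k) 𝓘(ℝ, E) ∞ (fun x : Fin k → M => ρ (x ∘ c) • x t)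
      {x | x ∘ c ∈ S} :=
    ContMDiffOn.smul (I := 𝓘(ℝ, F))
      (hρ.smooth.comp (contMDiff_pow_comp c).contMDiffOn fun x hx => hx)
      (contMDiff_pow_apply t).contMDiffOn
  have ho : IsOpen {x : Fin k → M | x ∘ c ∈ S} :=
    hρ.isOpen.preimage (by fun_prop : Continuous fun x : Fin k → M => x ∘ c)
  refine ⟨hs.continuousOn.isOpen_inter_preimage ho hT, ?_, ?_⟩
  · exact hu.comp (hs.mono fun x hx => hx.1) fun x hx => hx.2
  · intro x hx
    filter_upwards [hρ.equivariant _ hx.1] with g hg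
    have : (g • x) ∘ c = g • (x ∘ c) := rfl
    simp only [this, hg, Pi.smul_apply, smul_smul, inv_mul_cancel_right]

/-- An order embedding keeping the first `m` indices and reaching a given one. -/
theorem exists_orderEmbedding_castLE {m k : ℕ} (h : m < k) (i : Fin k) :
    ∃ (σ : Fin (m + 1) ↪o Fin k) (t : Fin (m + 1)),
      (∀ a : Fin m, σ a.castSucc = Fin.castLE h.le a) ∧ σ t = i := by
  -- If `i` is already among the first `m` indices, index `m` serves as padding; hence `max i m` and
  -- the need for `m < k`.
  let f : Fin (m + 1) → Fin k := fun a =>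
    if (a : ℕ) < m then ⟨a, by omega⟩ else ⟨max i m, by omega⟩
  have hf : StrictMono f := by
    intro a b hab
    have := b.is_lt
    have : (a : ℕ) < b := hab
    have ha : (a : ℕ) < m := by omega
    rw [Fin.lt_def]
    simp only [f, ha, if_true]
    split_ifs
    · exact this
    · exact lt_max_of_lt_right ha
  refine ⟨OrderEmbedding.ofStrictMono f hf,
    if hi : (i : ℕ) < m then ⟨i, by omega⟩ else Fin.last m, fun a => ?_, ?_⟩
  · ext
    simp [f]
  · ext
    simp only [OrderEmbedding.coe_ofStrictMono, f]
    split_ifs <;> simp_all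

/-- Where the first `m` components admit a moving frame, the joint invariants depend functionally
on liftings of `(m + 1)`-joint invariants. -/
theorem IsMovingFrameOn.functionallyDependentAt [FiniteDimensional ℝ E] [LieGroup 𝓘(ℝ, F) ∞ G]
    [IsManifold 𝓘(ℝ, E) ∞ M] {m k : ℕ} (hmk : m < k) {S : Set (Fin m → M)}
    {ρ : (Fin m → M) → G} (hρ : IsMovingFrameOn F E S ρ) {U : Set (Fin k → M)}
    {I : (Fin k → M) → ℝ} (hU : IsOpen U) (hI : IsLocalJointInvariant E G U I) {p : Fin k → M}
    (hp : p ∈ U) (hpS : p ∘ Fin.castLE hmk.le ∈ S) :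
    FunctionallyDependentAt E G (m + 1) I p := by
  -- With this normalization `ρ` takes values in `A` near `p`, and `β` fixes `p`, so that charts
  -- centred at the `p i` can be used.
  wlog h1 : ρ (p ∘ Fin.castLE hmk.le) = 1 generalizing ρ
  · exact this (hρ.const_mul (ρ (p ∘ Fin.castLE hmk.le))⁻¹) (inv_mul_cancel _)
  have : IsTopologicalGroup G := topologicalGroup_of_lieGroup 𝓘(ℝ, F) ∞
  have : ContinuousSMul G M := ContMDiffSMul.continuousSMul (I := 𝓘(ℝ, F)) (I' := 𝓘(ℝ, E)) ∞
  have : LocallyConnectedSpace G := ChartedSpace.locallyConnectedSpace F G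
  obtain ⟨A, O₀, hAo, h1A, hO₀, hpO₀, hAU⟩ := hI.exists_nhds_apply_smul_eq hU hp
  set c : Fin m → Fin k := Fin.castLE hmk.le with hc
  let φ : ∀ i, PartialEquiv M E := fun i => extChartAt 𝓘(ℝ, E) (p i)
  let b := Module.finBasis ℝ E
  set d := Module.finrank ℝ E with hd
  let β : (Fin k → M) → Fin k → M := fun q => ρ (q ∘ c) • q
  have hS₀ : IsOpen {q : Fin k → M | q ∘ c ∈ S} :=
    hρ.isOpen.preimage (by fun_prop : Continuous fun q : Fin k → M => q ∘ c)
  have hρc : ContinuousOn (fun q : Fin k → M => ρ (q ∘ c)) {q | q ∘ c ∈ S} :=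
    hρ.smooth.continuousOn.comp (by fun_prop) fun q hq => hq
  have hβc : ContinuousOn β {q | q ∘ c ∈ S} := hρc.smul continuousOn_id
  set V : Set (Fin k → M) := Set.univ.pi fun i => (φ i).source with hV
  have hVo : IsOpen V := isOpen_set_pi Set.finite_univ fun i _ => isOpen_extChartAt_source _
  set O : Set (Fin k → M) := O₀ ∩ (({q | q ∘ c ∈ S} ∩ β ⁻¹' V) ∩
    ({q | q ∘ c ∈ S} ∩ (fun q => ρ (q ∘ c)) ⁻¹' A)) with hO
  have hOo : IsOpen O := hO₀.inter ((hβc.isOpen_inter_preimage hS₀ hVo).inter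
    (hρc.isOpen_inter_preimage hS₀ hAo))
  have hpO : p ∈ O := by
    refine ⟨hpO₀, ⟨hpS, ?_⟩, hpS, ?_⟩
    · have : β p = p := by simp only [β, h1, one_smul]
      rw [Set.mem_preimage, this]
      exact fun i _ => mem_extChartAt_source _
    · rw [Set.mem_preimage, h1]
      exact h1A
  -- The index `j` encodes a component `i` and a coordinate `l`: these are the `d` coordinates of
  -- each moved point `ρ • q i`.
  let h : Fin (k * d) → (Fin k → M) → ℝ := fun j q =>
    b.coord (finProdFinEquiv.symm j).2
      (φ (finProdFinEquiv.symm j).1 (ρ (q ∘ c) • q (finProdFinEquiv.symm j).1))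
  have hu : ∀ (i : Fin k) (l : Fin d), ContMDiffOn 𝓘(ℝ, E) 𝓘(ℝ, ℝ) ∞
      (fun y => b.coord l (φ i y)) (φ i).source := by
    intro i l
    have h2 := contMDiffOn_extChartAt (I := 𝓘(ℝ, E)) (n := ∞) (x := p i)
    rw [← extChartAt_source 𝓘(ℝ, E)] at h2
    exact (LinearMap.toContinuousLinearMap (b.coord l)).contMDiff.comp_contMDiffOn h2
  have hh : ∀ j, ContMDiffOn (powModel E k) 𝓘(ℝ, ℝ) ∞ (h j) O := fun j =>
    (hρ.isLocalJointInvariant c (finProdFinEquiv.symm j).1 (isOpen_extChartAt_source _)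
      (hu _ _)).2.smooth.mono fun q hq => ⟨hq.2.1.1, hq.2.1.2 _ trivial⟩
  let s : (Fin (k * d) → ℝ) →L[ℝ] (Fin k → E) := ContinuousLinearMap.pi fun i =>
    ∑ l, (ContinuousLinearMap.proj (R := ℝ) (φ := fun _ : Fin (k * d) => ℝ)
      (finProdFinEquiv (i, l))).smulRight (b l)
  have hsh : ∀ q i, s (fun j => h j q) i = φ i (β q i) := by
    intro q i
    simp only [s, ContinuousLinearMap.pi_apply, sum_apply,
      ContinuousLinearMap.smulRight_apply, ContinuousLinearMap.proj_apply, h,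
      Equiv.symm_apply_apply, Module.Basis.coord_apply]
    exact b.sum_repr _
  -- `κ` recovers the moved tuple `β q` from the values `h j q`, so `I ∘ κ` serves as `Φ`.
  let κ : (Fin (k * d) → ℝ) → Fin k → M := fun t i => (φ i).symm (s t i)
  set D₀ : Set (Fin (k * d) → ℝ) := s ⁻¹' Set.univ.pi fun i => (φ i).target with hD₀
  have hD₀o : IsOpen D₀ := (isOpen_set_pi Set.finite_univ fun i _ =>
    isOpen_extChartAt_target _).preimage s.continuous
  have hκ : ContMDiffOn 𝓘(ℝ, Fin (k * d) → ℝ) (powModel E k) ∞ κ D₀ := by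
    refine contMDiffOn_pow.2 fun i => (contMDiffOn_extChartAt_symm (p i)).comp
      (((contDiff_apply ℝ E i).comp s.contDiff).contMDiff.contMDiffOn) fun t ht => ht i trivial
  have hDo : IsOpen (D₀ ∩ κ ⁻¹' U) := hκ.continuousOn.isOpen_inter_preimage hD₀o hU
  have hΦ : ContDiffOn ℝ ∞ (I ∘ κ) (D₀ ∩ κ ⁻¹' U) := contMDiffOn_iff_contDiffOn.1
    (hI.smooth.comp (hκ.mono Set.inter_subset_left) fun t ht => ht.2)
  have hIΦ : ∀ q ∈ O, (fun j => h j q) ∈ D₀ ∩ κ ⁻¹' U ∧ I q = (I ∘ κ) fun j => h j q := by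
    intro q hq
    have e1 : κ (fun j => h j q) = β q := by
      funext i
      simp only [κ, hsh]
      exact (φ i).left_inv (hq.2.1.2 i trivial)
    have e2 := hAU _ hq.2.2.2 q hq.1
    refine ⟨⟨fun i _ => ?_, ?_⟩, ?_⟩
    · rw [hsh]
      exact (φ i).map_source (hq.2.1.2 i trivial)
    · rw [Set.mem_preimage, e1]
      exact e2.1
    · rw [Function.comp_apply, e1]
      exact e2.2.symm
  refine ⟨O, k * d, h, hOo, hpO, fun j => ?_, ⟨_, _, hDo, hΦ, hIΦ⟩,
    exists_mvfderiv_eq_sum hOo hh hDo hΦ hIΦ⟩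
  obtain ⟨σ, t, hσ, ht⟩ := exists_orderEmbedding_castLE hmk (finProdFinEquiv.symm j).1
  have hinv := hρ.isLocalJointInvariant (Fin.castSucc : Fin m → Fin (m + 1)) t
    (isOpen_extChartAt_source (I := 𝓘(ℝ, E)) (p (finProdFinEquiv.symm j).1))
    (hu (finProdFinEquiv.symm j).1 (finProdFinEquiv.symm j).2)
  refine ⟨σ, _, _, hinv.1, hinv.2, fun q hq => ?_⟩
  have e1 : (q ∘ σ) ∘ Fin.castSucc = q ∘ c := funext fun a => congrArg q (hσ a)
  have e2 : (q ∘ σ) t = q (finProdFinEquiv.symm j).1 := congrArg q ht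
  refine ⟨?_, ?_⟩
  · rw [Set.mem_ofPred_eq, e1, e2]
    exact ⟨hq.2.1.1, hq.2.1.2 _ trivial⟩
  · simp only [e1, e2, h, φ]

end Invariants

/-- Tuples whose restriction to the first `m` components lies in a dense set are dense. -/
theorem dense_preimage_castLE {M : Type*} [TopologicalSpace M] {m k : ℕ} (h : m ≤ k)
    {R : Set (Fin m → M)} (hR : Dense R) : Dense {q : Fin k → M | q ∘ Fin.castLE h ∈ R} := by
  refine dense_iff_inter_open.2 fun U hU ⟨q, hq⟩ => ?_
  -- Only the first `m` components of `q` are varied.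
  let e : (Fin m → M) → Fin k → M := fun x i => if hi : (i : ℕ) < m then x ⟨i, hi⟩ else q i
  have he : Continuous e := by
    refine continuous_pi fun i => ?_
    by_cases hi : (i : ℕ) < m
    · simpa only [e, dif_pos hi] using continuous_apply _
    · simpa only [e, dif_neg hi] using continuous_const
  have heq : e (q ∘ Fin.castLE h) = q := by
    funext i
    by_cases hi : (i : ℕ) < m <;> simp [e, hi]
  obtain ⟨x, hxU, hxR⟩ := hR.inter_open_nonempty _ (hU.preimage he)
    ⟨q ∘ Fin.castLE h, by rwa [Set.mem_preimage, heq]⟩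
  refine ⟨e x, hxU, ?_⟩
  have : e x ∘ Fin.castLE h = x := by
    funext a
    simp [e]
  rwa [Set.mem_ofPred_eq, this]

end JointInvariants

theorem mainTheorem1
    {F : Type*} [NormedAddCommGroup F] [NormedSpace ℝ F] [FiniteDimensional ℝ F]
    {E : Type*} [NormedAddCommGroup E] [NormedSpace ℝ E] [FiniteDimensional ℝ E]
    {G : Type*} [TopologicalSpace G] [ChartedSpace F G] [Group G] [LieGroup 𝓘(ℝ, F) ∞ G]
    [ConnectedSpace G]
    {M : Type*} [TopologicalSpace M] [ChartedSpace E M] [IsManifold 𝓘(ℝ, E) ∞ M]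
    [MulAction G M] [ContMDiffSMul 𝓘(ℝ, F) 𝓘(ℝ, E) ∞ G M]
    (hfaithful : JointInvariants.LocallyFaithful F E G M) :
    ∃ k₀ : ℕ, JointInvariants.IsLocalRank F E G M k₀ ∧
      ∃ k₁ : ℕ, k₁ ≤ k₀ + 2 ∧
        ∀ k : ℕ, k₁ < k →
          ∃ W : Set (Fin k → M), IsOpen W ∧ Dense W ∧
            ∀ (U : Set (Fin k → M)) (I : (Fin k → M) → ℝ), IsOpen U →
              JointInvariants.IsLocalJointInvariant E G U I →
                ∀ p ∈ U ∩ W, JointInvariants.FunctionallyDependentAt E G k₁ I p := by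

  obtain ⟨k₀, hk₀⟩ := JointInvariants.exists_isLocalRank hfaithful
  refine ⟨k₀, hk₀, k₀ + 1, by omega, fun k hk => ?_⟩
  have hle : k₀ < k := by omega
  -- Defining `W` by existence of a frame, rather than by regularity of the first `k₀` points, makes
  -- openness immediate; density follows because regular tuples have frames.
  refine ⟨{q | ∃ (S : Set (Fin k₀ → M)) (ρ : (Fin k₀ → M) → G),
    q ∘ Fin.castLE hle.le ∈ S ∧ JointInvariants.IsMovingFrameOn F E S ρ}, ?_, ?_, ?_⟩
  · refine isOpen_iff_mem_nhds.2 fun q ⟨S, ρ, hq, hρ⟩ => ?_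
    have hc : Continuous fun q : Fin k → M => q ∘ Fin.castLE hle.le := by fun_prop
    filter_upwards [(hρ.isOpen.preimage hc).mem_nhds hq] with x hx
    exact ⟨S, ρ, hx, hρ⟩
  · exact (JointInvariants.dense_preimage_castLE hle.le hk₀.1).mono
      fun q hq => hq.exists_isMovingFrameOn
  · rintro U I hU hI p ⟨hpU, S, ρ, hpS, hρ⟩
    exact hρ.functionallyDependentAt hle hU hI hpU hpS
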